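/- A \emph{partial ring} is a set $A$ with elements $0,1$, a set $A_2\subseteq A\times A$ of summable pairs with a map $+\colon A_2\to A$, and a commutative associative multiplication with unit $1$, such that: $(a,0),(0,a)\in A_2$ and $a+0=0+a=a$; $(a,b)\in A_2$ implies $(b,a)\in A_2$ and $a+b=b+a$; one has $(a,b),(a+b,c)\in A_2$ if and only if $(b,c),(a,b+c)\in A_2$, and then $(a+b)+c=a+(b+c)$; $0\cdot a=0$; and $(a,b)\in A_2$ implies $(ax,bx)\in A_2$ and $ax+bx=(a+b)x$. Homomorphisms of partial rings preserve $0$, $1$, products and all existing sums. An ideal is a subset containing $0$ that is closed under existing sums and under multiplication by elements of $A$; it is prime if it is proper and $ab\in I$ implies $a\in I$ or $b\in I$. A partial ring is local if it has a unique maximal ideal; a homomorphism of local partial rings is one for which the preimage of the maximal ideal is the maximal ideal. A locally partial-ringed space is a topological space with a sheaf of partial rings whose stalks are local; a morphism $X\to Y$ of such spaces is a continuous map $f\colon X\to Y$ with a homomorphism of sheaves of partial rings $f^\#\colon\mathcal O_Y\to f_*\mathcal O_X$ that induces homomorphisms of local partial rings $\mathcal O_{Y,f(x)}\to\mathcal O_{X,x}$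 for all $x\in X$. For a multiplicative subset $S$ of a partial ring $A$, the localization $S^{-1}A$ consists of the usual fractions $a/s$, where $(a/s,b/t)$ is summable if and only if $(uta,usb)\in A_2$ for some $u\in S$, with sum $(uta+usb)/(uts)$. Let $\operatorname{Spec}A$ be the locally partial-ringed space whose points are the prime ideals of $A$, whose topology is generated by the sets $D(a)=\{\mathfrak p : a\notin\mathfrak p\}$, and whose structure sheaf is the sheafification of $U\mapsto S_U^{-1}A$ with $S_U=\{a\in A : a\notin\mathfrak p \text{ for all } \mathfrak p\in U\}$. Write $\Gamma(\operatorname{Spec}A)$ for its partial ring of global sections and $\gamma_A\colon A\to\Gamma(\operatorname{Spec}A)$, $a\mapsto a/1$, for the canonical homomorphism. \textbf{Corollary.} Let $A$ and $B$ be partial rings. Then the map $$\{\text{morphisms }\operatorname{Spec}A\to\operatorname{Spec}B\text{ of locally partial-ringed spaces}\}\longrightarrow\{\text{homomorphisms }B\to\Gamma(\operatorname{Spec}A)\text{ of partial rings}\},$$ $$f\longmapsto \Gamma(f)\circ\gamma_B,$$ where $\Gamma(f)\colon\Gamma(\operatorname{Spec}B)\to\Gamma(\operatorname{Spec}A)$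 is the homomorphism induced by $f^\#$ on global sections, is bijective. -/

import Mathlib

open CategoryTheory TopologicalSpace Opposite

universe u

namespace PartialSchemes

/-! ### Partial monoids and partial rings -/

/-- A (commutative, unital) partial magma.  The partial operation is a partial function:
`(padd a b).Dom` says that the pair `(a, b)` is summable, i.e. lies in `A₂ ⊆ A × A`, and
`c ∈ padd a b` says that `(a, b)` is summable with sum `c`. -/
class PartialMagma (A : Type u) extends Zero A where
  padd : A → A → Part A
  padd_zero : ∀ a, padd a 0 = Part.some a
  padd_comm : ∀ a b, padd a b = padd b a

open PartialMagma

/-- A partial monoid: `(a + b) + c` is defined if and only if `a + (b + c)` is, and in that case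
they are equal. -/
class PartialMonoid (A : Type u) extends PartialMagma A where
  padd_assoc : ∀ a b c : A,
    ((padd a b).bind fun d => padd d c) = (padd b c).bind fun d => padd a d

/-- A partial ring: a partial monoid with a bilinear, associative, commutative and unital
multiplication. -/
class PartialRing (A : Type u) extends PartialMonoid A, CommMonoidWithZero A where
  mul_padd : ∀ a b c x : A, c ∈ padd a b → c * x ∈ padd (a * x) (b * x)

/-- Homomorphisms of partial rings: multiplicative maps preserving `0`, `1` and all existing
sums. -/
structure PRingHom (A B : Type u) [PartialRing A] [PartialRing B] extends A →*₀ B where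
  map_padd' : ∀ a b c : A, c ∈ padd a b → toFun c ∈ padd (toFun a) (toFun b)

section Basic

variable {A B C : Type u} [PartialRing A] [PartialRing B] [PartialRing C]

instance : FunLike (PRingHom A B) A B where
  coe f := f.toFun
  coe_injective f g h := by
    rcases f with ⟨f, hf⟩
    rcases g with ⟨g, hg⟩
    have : f = g := DFunLike.coe_injective h
    subst this
    rfl

instance : MonoidWithZeroHomClass (PRingHom A B) A B where
  map_mul f := f.map_mul'
  map_one f := f.map_one'
  map_zero f := f.map_zero'

theorem PRingHom.map_padd (f : PRingHom A B) {a b c : A} (h : c ∈ padd a b) :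
    f c ∈ padd (f a) (f b) :=
  f.map_padd' a b c h

@[ext]
theorem PRingHom.ext {f g : PRingHom A B} (h : ∀ a, f a = g a) : f = g :=
  DFunLike.ext f g h

/-- The identity homomorphism. -/
def PRingHom.id (A : Type u) [PartialRing A] : PRingHom A A where
  toMonoidWithZeroHom := MonoidWithZeroHom.id A
  map_padd' _ _ _ h := h

/-- Composition of homomorphisms. -/
def PRingHom.comp (g : PRingHom B C) (f : PRingHom A B) : PRingHom A C where
  toMonoidWithZeroHom := g.toMonoidWithZeroHom.comp f.toMonoidWithZeroHom
  map_padd' _ _ _ h := g.map_padd (f.map_padd h)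

theorem padd_assoc_exists {a b c d e : A} (h : d ∈ padd a b) (h' : e ∈ padd d c) :
    ∃ f, f ∈ padd b c ∧ e ∈ padd a f := by
  have h2 : e ∈ (padd a b).bind fun d => padd d c := Part.mem_bind_iff.2 ⟨d, h, h'⟩
  rw [PartialMonoid.padd_assoc] at h2
  exact Part.mem_bind_iff.1 h2

end Basic

/-- `R a b c` is the graph of a partial addition turning the multiplicative monoid `A` into a
partial ring. -/
structure IsAddGraph {A : Type u} [CommMonoidWithZero A] (R : A → A → A → Prop) : Prop where
  functional : ∀ a b c d, R a b c → R a b d → c = d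
  zero : ∀ a, R a 0 a
  symm : ∀ a b c, R a b c → R b a c
  assoc : ∀ a b c d e, R a b d → R d c e → ∃ f, R b c f ∧ R a f e
  mul : ∀ a b c x, R a b c → R (a * x) (b * x) (c * x)

/-- The partial function with graph `R a b`. -/
noncomputable def graphPart {A : Type u} (R : A → A → A → Prop) (a b : A) : Part A :=
  ⟨∃ c, R a b c, fun h => h.choose⟩

theorem mem_graphPart {A : Type u} [CommMonoidWithZero A] {R : A → A → A → Prop}
    (hR : IsAddGraph R) {a b c : A} : c ∈ graphPart R a b ↔ R a b c :=
  ⟨fun ⟨h, hc⟩ => hc ▸ h.choose_spec, fun h =>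
    ⟨⟨c, h⟩, hR.functional _ _ _ _ (Exists.choose_spec (⟨c, h⟩ : ∃ c, R a b c)) h⟩⟩

/-- The partial ring whose partial addition has the graph `R`: `R a b c` means that
`(a, b)` is summable and `a + b = c`. -/
@[reducible]
noncomputable def PartialRing.ofGraph {A : Type u} [CommMonoidWithZero A] (R : A → A → A → Prop)
    (hR : IsAddGraph R) : PartialRing A :=
  { ‹CommMonoidWithZero A› with
    padd := graphPart R
    padd_zero := fun a => Part.ext fun c => by
      rw [mem_graphPart hR, Part.mem_some_iff]
      exact ⟨fun h => hR.functional _ _ _ _ h (hR.zero a), fun h => h ▸ hR.zero a⟩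
    padd_comm := fun a b => Part.ext fun c => by
      rw [mem_graphPart hR, mem_graphPart hR]
      exact ⟨hR.symm _ _ _, hR.symm _ _ _⟩
    padd_assoc := fun a b c => Part.ext fun e => by
      simp only [Part.mem_bind_iff, mem_graphPart hR]
      constructor
      · rintro ⟨d, h, h'⟩
        exact hR.assoc _ _ _ _ _ h h'
      · rintro ⟨d, h, h'⟩
        obtain ⟨f, h1, h2⟩ := hR.assoc _ _ _ _ _ (hR.symm _ _ _ h) (hR.symm _ _ _ h')
        exact ⟨f, hR.symm _ _ _ h1, hR.symm _ _ _ h2⟩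
    mul_padd := fun a b c x => by
      rw [mem_graphPart hR, mem_graphPart hR]
      exact hR.mul a b c x }

/-! ### Ideals, prime ideals and local partial rings -/

/-- Ideals of a partial ring: they contain `0`, are closed under all existing sums and under
multiplication by arbitrary elements. -/
@[ext]
structure PIdeal (A : Type u) [PartialRing A] where
  carrier : Set A
  zero_mem : (0 : A) ∈ carrier
  padd_mem : ∀ a b c, a ∈ carrier → b ∈ carrier → c ∈ padd a b → c ∈ carrier
  mul_mem : ∀ a x, x ∈ carrier → a * x ∈ carrier

instance {A : Type u} [PartialRing A] : SetLike (PIdeal A) A where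
  coe := PIdeal.carrier
  coe_injective _ _ h := PIdeal.ext h

namespace PIdeal

variable {A B : Type u} [PartialRing A] [PartialRing B]

/-- Prime ideals. -/
def IsPrime (I : PIdeal A) : Prop :=
  (I : Set A) ≠ Set.univ ∧ ∀ a b : A, a * b ∈ I → a ∈ I ∨ b ∈ I

/-- Maximal ideals: proper ideals that are maximal among the proper ideals. -/
def IsMaximal (I : PIdeal A) : Prop :=
  (I : Set A) ≠ Set.univ ∧
    ∀ J : PIdeal A, (J : Set A) ≠ Set.univ → (I : Set A) ⊆ J → J = I

/-- The preimage of an ideal under a homomorphism. -/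
def comap (f : PRingHom A B) (J : PIdeal B) : PIdeal A where
  carrier := {a | f a ∈ J}
  zero_mem := by
    change f 0 ∈ J
    rw [map_zero]
    exact J.zero_mem
  padd_mem a b c ha hb hc := J.padd_mem _ _ _ ha hb (f.map_padd hc)
  mul_mem a x hx := by
    change f (a * x) ∈ J
    rw [map_mul]
    exact J.mul_mem _ _ hx

theorem one_notMem (I : PIdeal A) (h : (I : Set A) ≠ Set.univ) : (1 : A) ∉ I := fun h1 =>
  h (Set.eq_univ_of_forall fun a => mul_one a ▸ I.mul_mem a 1 h1)

/-- The multiplicative subset `A \ 𝔭`. -/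
def primeCompl (I : PIdeal A) (hI : I.IsPrime) : Submonoid A where
  carrier := {a | a ∉ I}
  one_mem' := I.one_notMem hI.1
  mul_mem' ha hb h := (hI.2 _ _ h).elim ha hb

end PIdeal

/-- A local partial ring: a partial ring with a unique maximal ideal. -/
class IsLocalPRing (A : Type u) [PartialRing A] : Prop where
  existsUnique : ∃! I : PIdeal A, I.IsMaximal

/-- The maximal ideal of a local partial ring. -/
noncomputable def maximalIdeal (A : Type u) [PartialRing A] [IsLocalPRing A] : PIdeal A :=
  (IsLocalPRing.existsUnique (A := A)).choose

/-- Homomorphisms of local partial rings: the preimage of the maximal ideal is the maximal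
ideal. -/
def PRingHom.IsLocal {A B : Type u} [PartialRing A] [PartialRing B] [IsLocalPRing A]
    [IsLocalPRing B] (f : PRingHom A B) : Prop :=
  (maximalIdeal B).comap f = maximalIdeal A

/-- A proper ideal all of whose non-elements are units is the unique maximal ideal. -/
theorem existsUnique_isMaximal {A : Type u} [PartialRing A] (I : PIdeal A)
    (hI : (I : Set A) ≠ Set.univ) (h : ∀ a, a ∉ I → ∃ b, b * a = 1) :
    ∃! I : PIdeal A, I.IsMaximal := by
  have key : ∀ J : PIdeal A, (J : Set A) ≠ Set.univ → (J : Set A) ⊆ I := by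
    intro J hJ a ha
    by_contra haI
    obtain ⟨b, hb⟩ := h a haI
    exact J.one_notMem hJ (hb ▸ J.mul_mem b a ha)
  refine ⟨I, ⟨hI, fun J hJ hIJ => SetLike.coe_injective ((key J hJ).antisymm hIJ)⟩, ?_⟩
  intro J hJ
  exact (hJ.2 I hI (key J hJ.1)).symm

/-! ### Localization -/

section Localization

variable {A : Type u} [PartialRing A] (S : Submonoid A)

/-- The graph of the addition on `S⁻¹A`: fractions are added after passing to a common
denominator. -/
def LocRel (x y z : Localization S) : Prop :=
  ∃ (a b c : A) (s : S), c ∈ padd a b ∧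
    x = Localization.mk a s ∧ y = Localization.mk b s ∧ z = Localization.mk c s

variable {S}

theorem mk_eq_iff {a b : A} {s t : S} :
    Localization.mk a s = Localization.mk b t ↔ ∃ u : S, (u : A) * (t * a) = u * (s * b) := by
  rw [Localization.mk_eq_mk_iff, Localization.r_iff_exists]

theorem isAddGraph_locRel : IsAddGraph (LocRel S) :=
  ⟨by
      rintro x y z w ⟨a, b, c, s, h, rfl, rfl, rfl⟩ ⟨a', b', c', s', h', ha, hb, rfl⟩
      obtain ⟨u, hu⟩ := mk_eq_iff.1 ha
      obtain ⟨v, hv⟩ := mk_eq_iff.1 hb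
      rw [mk_eq_iff]
      refine ⟨u * v, ?_⟩
      have h1 := PartialRing.mul_padd _ _ _ ((u : A) * v * s') h
      have h2 := PartialRing.mul_padd _ _ _ ((u : A) * v * s) h'
      have e1 : a * ((u : A) * v * s') = a' * ((u : A) * v * s) := by
        calc a * ((u : A) * v * s') = v * (u * (s' * a)) := by ac_rfl
          _ = _ := by rw [hu]; ac_rfl
      have e2 : b * ((u : A) * v * s') = b' * ((u : A) * v * s) := by
        calc b * ((u : A) * v * s') = u * (v * (s' * b)) := by ac_rfl
          _ = _ := by rw [hv]; ac_rfl
      rw [e1, e2] at h1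
      have h3 := Part.mem_unique h1 h2
      calc ((u * v : S) : A) * (s' * c) = c * ((u : A) * v * s') := by
            rw [Submonoid.coe_mul]; ac_rfl
        _ = _ := by rw [h3, Submonoid.coe_mul]; ac_rfl,
    by
      intro x
      induction x using Localization.induction_on with
      | H y =>
        refine ⟨y.1, 0, y.1, y.2, ?_, rfl, (Localization.mk_zero y.2).symm, rfl⟩
        rw [PartialMagma.padd_zero]
        exact Part.mem_some _,
    by
      rintro x y z ⟨a, b, c, s, h, rfl, rfl, rfl⟩
      refine ⟨b, a, c, s, ?_, rfl, rfl, rfl⟩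
      rwa [PartialMagma.padd_comm],
    by
      rintro x y z d e ⟨a, b, c, s, h, rfl, rfl, rfl⟩ ⟨c', g, k, t, h', hc, rfl, rfl⟩
      obtain ⟨u, hu⟩ := mk_eq_iff.1 hc
      have h1 := PartialRing.mul_padd _ _ _ ((u : A) * t) h
      have h2 := PartialRing.mul_padd _ _ _ ((u : A) * s) h'
      have e1 : c * ((u : A) * t) = c' * ((u : A) * s) := by
        calc c * ((u : A) * t) = u * (t * c) := by ac_rfl
          _ = _ := by rw [hu]; ac_rfl
      rw [← e1] at h2
      obtain ⟨f, hf, hf'⟩ := padd_assoc_exists h1 h2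
      have r1 : ∀ x : A, Localization.mk x s = Localization.mk (x * ((u : A) * t)) (u * t * s) := by
        intro x
        rw [mk_eq_iff]
        refine ⟨1, ?_⟩
        simp only [Submonoid.coe_mul]
        ac_rfl
      have r2 : ∀ x : A, Localization.mk x t = Localization.mk (x * ((u : A) * s)) (u * t * s) := by
        intro x
        rw [mk_eq_iff]
        refine ⟨1, ?_⟩
        simp only [Submonoid.coe_mul]
        ac_rfl
      exact ⟨Localization.mk f (u * t * s), ⟨_, _, _, _, hf, r1 b, r2 g, rfl⟩,
        ⟨_, _, _, _, hf', r1 a, rfl, r2 k⟩⟩,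
    by
      rintro x y z w ⟨a, b, c, s, h, rfl, rfl, rfl⟩
      induction w using Localization.induction_on with
      | H w =>
        refine ⟨_, _, _, s * w.2, PartialRing.mul_padd _ _ _ w.1 h, ?_, ?_, ?_⟩ <;>
        exact Localization.mk_mul _ _ _ _⟩

/-- The partial ring structure on the localization `S⁻¹A`. -/
noncomputable instance : PartialRing (Localization S) :=
  PartialRing.ofGraph (LocRel S) isAddGraph_locRel

theorem mem_padd_localization {x y z : Localization S} : z ∈ padd x y ↔ LocRel S x y z :=
  mem_graphPart isAddGraph_locRel

/-- `a/s` and `b/t` are summable in `S⁻¹A` if and only if `uta` and `usb` are summable in `A`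
for some `u ∈ S`, and then the sum is `(uta + usb)/(uts)`. -/
theorem mem_padd_mk_iff {a b : A} {s t : S} {z : Localization S} :
    z ∈ padd (Localization.mk a s) (Localization.mk b t) ↔
      ∃ (u : S) (c : A), c ∈ padd ((u : A) * t * a) ((u : A) * s * b) ∧
        z = Localization.mk c (u * t * s) := by
  have r1 : ∀ (u : S) (x : A) (s t : S),
      Localization.mk x s = Localization.mk ((u : A) * t * x) (u * t * s) := by
    intro u x s t
    rw [mk_eq_iff]
    refine ⟨1, ?_⟩
    simp only [Submonoid.coe_mul]
    ac_rfl
  have r2 : ∀ (u : S) (x : A) (s t : S),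
      Localization.mk x t = Localization.mk ((u : A) * s * x) (u * t * s) := by
    intro u x s t
    rw [mul_right_comm u t s]
    exact r1 u x t s
  constructor
  · intro h0
    obtain ⟨a', b', c', r, h, ha, hb, rfl⟩ := mem_padd_localization.1 h0
    obtain ⟨v, hv⟩ := mk_eq_iff.1 ha
    obtain ⟨w, hw⟩ := mk_eq_iff.1 hb
    have h1 := PartialRing.mul_padd _ _ _ ((v : A) * w * s * t) h
    have e1 : a' * ((v : A) * w * s * t) = ((v * w * r : S) : A) * t * a := by
      calc a' * ((v : A) * w * s * t) = w * t * (v * (s * a')) := by ac_rfl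
        _ = _ := by rw [← hv]; simp only [Submonoid.coe_mul]; ac_rfl
    have e2 : b' * ((v : A) * w * s * t) = ((v * w * r : S) : A) * s * b := by
      calc b' * ((v : A) * w * s * t) = v * s * (w * (t * b')) := by ac_rfl
        _ = _ := by rw [← hw]; simp only [Submonoid.coe_mul]; ac_rfl
    rw [e1, e2] at h1
    refine ⟨v * w * r, _, h1, ?_⟩
    rw [mk_eq_iff]
    refine ⟨1, ?_⟩
    simp only [Submonoid.coe_mul]
    ac_rfl
  · rintro ⟨u, c, hc, rfl⟩
    exact mem_padd_localization.2 ⟨_, _, c, _, hc, r1 u a s t, r2 u b s t, rfl⟩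

end Localization

/-! ### The category of partial rings -/

/-- The category of partial rings. -/
structure PRingCat : Type (u + 1) where
  carrier : Type u
  [str : PartialRing carrier]

attribute [instance] PRingCat.str

instance : CoeSort PRingCat.{u} (Type u) := ⟨PRingCat.carrier⟩

instance : Category PRingCat.{u} where
  Hom A B := PRingHom A B
  id A := PRingHom.id A
  comp f g := PRingHom.comp g f

instance : ConcreteCategory PRingCat.{u} (fun A B => PRingHom A B) where
  hom f := f
  ofHom f := f

theorem map_map_apply {X : TopCat.{u}} (F : X.Presheaf PRingCat.{u}) {U V W : (Opens X)ᵒᵖ}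
    (i : U ⟶ V) (j : V ⟶ W) (k : U ⟶ W) (s : F.obj U) : F.map j (F.map i s) = F.map k s := by
  have : k = i ≫ j := Subsingleton.elim _ _
  rw [this, F.map_comp]
  rfl

/-! ### Stalks of a presheaf of partial rings -/

section Stalk

variable {X : TopCat.{u}} (F : X.Presheaf PRingCat.{u}) (x : X)

/-- A section of `F` over some open neighbourhood of `x`. -/
structure PreGerm where
  nbhd : Opens X
  mem : x ∈ nbhd
  sec : F.obj (op nbhd)

/-- Two sections near `x` are identified if they agree on a smaller neighbourhood of `x`. -/
instance PreGerm.setoid : Setoid (PreGerm F x) where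
  r s t := ∃ (W : Opens X) (_ : x ∈ W) (i : W ⟶ s.nbhd) (j : W ⟶ t.nbhd),
    F.map i.op s.sec = F.map j.op t.sec
  iseqv :=
    { refl := fun s => ⟨s.nbhd, s.mem, 𝟙 _, 𝟙 _, rfl⟩
      symm := fun ⟨W, hW, i, j, h⟩ => ⟨W, hW, j, i, h.symm⟩
      trans := by
        rintro s t r ⟨W, hW, i, j, h⟩ ⟨W', hW', i', j', h'⟩
        refine ⟨W ⊓ W', ⟨hW, hW'⟩, homOfLE inf_le_left ≫ i, homOfLE inf_le_right ≫ j', ?_⟩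
        have e1 := congrArg (F.map (homOfLE (inf_le_left : W ⊓ W' ≤ W)).op) h
        have e2 := congrArg (F.map (homOfLE (inf_le_right : W ⊓ W' ≤ W')).op) h'
        rw [map_map_apply F _ _ (homOfLE (inf_le_left.trans i.le)).op,
          map_map_apply F _ _ (homOfLE (inf_le_left.trans j.le)).op] at e1
        rw [map_map_apply F _ _ (homOfLE (inf_le_left.trans j.le)).op,
          map_map_apply F _ _ (homOfLE (inf_le_right.trans j'.le)).op] at e2
        exact e1.trans e2 }

/-- The stalk of `F` at `x`, that is, the set of germs at `x` of sections of `F`. -/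
def Stalk : Type u := Quotient (PreGerm.setoid F x)

variable {F x}

/-- The germ at `x` of a section. -/
def germ {U : Opens X} (hx : x ∈ U) (s : F.obj (op U)) : Stalk F x :=
  Quotient.mk (PreGerm.setoid F x) ⟨U, hx, s⟩

theorem germ_eq_iff {U V : Opens X} {hU : x ∈ U} {hV : x ∈ V} {s : F.obj (op U)}
    {t : F.obj (op V)} :
    germ hU s = germ hV t ↔ ∃ (W : Opens X) (_ : x ∈ W) (i : W ⟶ U) (j : W ⟶ V),
      F.map i.op s = F.map j.op t :=
  Quotient.eq

theorem germ_map {U V : Opens X} (hV : x ∈ V) (hU : x ∈ U) (i : V ⟶ U) (s : F.obj (op U)) :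
    germ hV (F.map i.op s) = germ hU s :=
  germ_eq_iff.2 ⟨V, hV, 𝟙 _, i, map_map_apply F i.op _ _ s⟩

theorem germ_surj (g : Stalk F x) : ∃ (U : Opens X) (hU : x ∈ U) (s : F.obj (op U)),
    g = germ hU s := by
  induction g using Quotient.inductionOn with
  | h s => exact ⟨s.nbhd, s.mem, s.sec, rfl⟩

end Stalk

section StalkRing

variable {X : TopCat.{u}} {F : X.Presheaf PRingCat.{u}} {x : X}

theorem germ_surj₂ (g h : Stalk F x) : ∃ (U : Opens X) (hU : x ∈ U) (s t : F.obj (op U)),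
    g = germ hU s ∧ h = germ hU t := by
  obtain ⟨U, hU, s, rfl⟩ := germ_surj g
  obtain ⟨V, hV, t, rfl⟩ := germ_surj h
  exact ⟨U ⊓ V, ⟨hU, hV⟩, F.map (homOfLE inf_le_left).op s, F.map (homOfLE inf_le_right).op t,
    (germ_map _ _ _ _).symm, (germ_map _ _ _ _).symm⟩

theorem germ_surj₃ (g h k : Stalk F x) :
    ∃ (U : Opens X) (hU : x ∈ U) (s t r : F.obj (op U)),
      g = germ hU s ∧ h = germ hU t ∧ k = germ hU r := by
  obtain ⟨U, hU, s, t, rfl, rfl⟩ := germ_surj₂ g h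
  obtain ⟨V, hV, r, rfl⟩ := germ_surj k
  exact ⟨U ⊓ V, ⟨hU, hV⟩, F.map (homOfLE inf_le_left).op s, F.map (homOfLE inf_le_left).op t,
    F.map (homOfLE inf_le_right).op r,
    (germ_map _ _ _ _).symm, (germ_map _ _ _ _).symm, (germ_map _ _ _ _).symm⟩

noncomputable instance : Mul (Stalk F x) where
  mul := Quotient.map₂
    (fun s t => ⟨s.nbhd ⊓ t.nbhd, ⟨s.mem, t.mem⟩,
      F.map (homOfLE inf_le_left).op s.sec * F.map (homOfLE inf_le_right).op t.sec⟩)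
    (by
      rintro s s' ⟨W, hW, i, i', h⟩ t t' ⟨V, hV, j, j', k⟩
      refine ⟨W ⊓ V, ⟨hW, hV⟩, homOfLE (inf_le_inf i.le j.le), homOfLE (inf_le_inf i'.le j'.le),
        ?_⟩
      have e1 := congrArg (F.map (homOfLE (inf_le_left : W ⊓ V ≤ W)).op) h
      have e2 := congrArg (F.map (homOfLE (inf_le_right : W ⊓ V ≤ V)).op) k
      rw [map_map_apply F _ _ (homOfLE (inf_le_left.trans i.le)).op,
        map_map_apply F _ _ (homOfLE (inf_le_left.trans i'.le)).op] at e1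
      rw [map_map_apply F _ _ (homOfLE (inf_le_right.trans j.le)).op,
        map_map_apply F _ _ (homOfLE (inf_le_right.trans j'.le)).op] at e2
      dsimp only
      rw [map_mul, map_mul,
        map_map_apply F _ _ (homOfLE (inf_le_left.trans i.le)).op,
        map_map_apply F _ _ (homOfLE (inf_le_left.trans i'.le)).op,
        map_map_apply F _ _ (homOfLE (inf_le_right.trans j.le)).op,
        map_map_apply F _ _ (homOfLE (inf_le_right.trans j'.le)).op, e1, e2])

noncomputable instance : One (Stalk F x) := ⟨germ (U := ⊤) trivial 1⟩

noncomputable instance : Zero (Stalk F x) := ⟨germ (U := ⊤) trivial 0⟩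

theorem germ_one {U : Opens X} (hU : x ∈ U) : germ hU (1 : F.obj (op U)) = 1 := by
  have := germ_map hU (U := ⊤) trivial (homOfLE le_top) (1 : F.obj (op ⊤))
  rw [map_one] at this
  exact this

theorem germ_zero {U : Opens X} (hU : x ∈ U) : germ hU (0 : F.obj (op U)) = 0 := by
  have := germ_map hU (U := ⊤) trivial (homOfLE le_top) (0 : F.obj (op ⊤))
  rw [map_zero] at this
  exact this

theorem germ_mul {U : Opens X} (hU : x ∈ U) (s t : F.obj (op U)) :
    germ hU (s * t) = germ hU s * germ hU t := by
  rw [← germ_map (V := U ⊓ U) ⟨hU, hU⟩ hU (homOfLE inf_le_left) (s * t), map_mul]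
  rfl

noncomputable instance : CommMonoidWithZero (Stalk F x) where
  mul_assoc a b c := by
    obtain ⟨U, hU, a, b, c, rfl, rfl, rfl⟩ := germ_surj₃ a b c
    rw [← germ_mul, ← germ_mul, ← germ_mul, ← germ_mul, mul_assoc]
  mul_comm a b := by
    obtain ⟨U, hU, a, b, rfl, rfl⟩ := germ_surj₂ a b
    rw [← germ_mul, ← germ_mul, mul_comm]
  one_mul a := by
    obtain ⟨U, hU, a, rfl⟩ := germ_surj a
    rw [← germ_one hU, ← germ_mul, one_mul]
  mul_one a := by
    obtain ⟨U, hU, a, rfl⟩ := germ_surj a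
    rw [← germ_one hU, ← germ_mul, mul_one]
  zero_mul a := by
    obtain ⟨U, hU, a, rfl⟩ := germ_surj a
    rw [← germ_zero hU, ← germ_mul, zero_mul]
  mul_zero a := by
    obtain ⟨U, hU, a, rfl⟩ := germ_surj a
    rw [← germ_zero hU, ← germ_mul, mul_zero]

variable (F x) in
/-- The graph of the addition of germs: two germs are summable if they are represented by
summable sections over a common neighbourhood. -/
def StalkRel (g h k : Stalk F x) : Prop :=
  ∃ (U : Opens X) (hU : x ∈ U) (s t r : F.obj (op U)), r ∈ padd s t ∧
    g = germ hU s ∧ h = germ hU t ∧ k = germ hU r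

theorem padd_map {U V : Opens X} (i : V ⟶ U) {a b c : F.obj (op U)} (h : c ∈ padd a b) :
    F.map i.op c ∈ padd (F.map i.op a) (F.map i.op b) :=
  PRingHom.map_padd (A := F.obj (op U)) (B := F.obj (op V)) (F.map i.op) h

theorem isAddGraph_stalkRel : IsAddGraph (StalkRel F x) where
  functional := by
    rintro _ _ _ _ ⟨U, hU, s, t, r, h, rfl, rfl, rfl⟩ ⟨V, hV, s', t', r', h', e1, e2, rfl⟩
    obtain ⟨W, hW, i, j, e1⟩ := germ_eq_iff.1 e1
    obtain ⟨W', hW', i', j', e2⟩ := germ_eq_iff.1 e2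
    refine germ_eq_iff.2 ⟨W ⊓ W', ⟨hW, hW'⟩, homOfLE (inf_le_left.trans i.le),
      homOfLE (inf_le_left.trans j.le), ?_⟩
    have e1 := congrArg (F.map (homOfLE (inf_le_left : W ⊓ W' ≤ W)).op) e1
    have e2 := congrArg (F.map (homOfLE (inf_le_right : W ⊓ W' ≤ W')).op) e2
    rw [map_map_apply F _ _ (homOfLE (inf_le_left.trans i.le)).op,
      map_map_apply F _ _ (homOfLE (inf_le_left.trans j.le)).op] at e1
    rw [map_map_apply F _ _ (homOfLE (inf_le_left.trans i.le)).op,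
      map_map_apply F _ _ (homOfLE (inf_le_left.trans j.le)).op] at e2
    have h1 := padd_map (homOfLE (inf_le_left.trans i.le) : W ⊓ W' ⟶ U) h
    have h2 := padd_map (homOfLE (inf_le_left.trans j.le) : W ⊓ W' ⟶ V) h'
    rw [e1, e2] at h1
    exact Part.mem_unique h1 h2
  zero g := by
    obtain ⟨U, hU, s, rfl⟩ := germ_surj g
    refine ⟨U, hU, s, 0, s, ?_, rfl, (germ_zero hU).symm, rfl⟩
    rw [PartialMagma.padd_zero]
    exact Part.mem_some _
  symm := by
    rintro _ _ _ ⟨U, hU, s, t, r, h, rfl, rfl, rfl⟩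
    rw [PartialMagma.padd_comm] at h
    exact ⟨U, hU, t, s, r, h, rfl, rfl, rfl⟩
  assoc := by
    rintro _ _ _ _ _ ⟨U, hU, a, b, d, h, rfl, rfl, rfl⟩ ⟨V, hV, d', c, e, h', e1, rfl, rfl⟩
    obtain ⟨W, hW, i, j, e1⟩ := germ_eq_iff.1 e1
    have h1 := padd_map i h
    have h2 := padd_map j h'
    rw [← e1] at h2
    obtain ⟨f, hf, hf'⟩ := padd_assoc_exists h1 h2
    exact ⟨germ hW f,
      ⟨W, hW, _, _, _, hf, (germ_map _ _ _ _).symm, (germ_map _ _ _ _).symm, rfl⟩,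
      ⟨W, hW, _, _, _, hf', (germ_map _ _ _ _).symm, rfl, (germ_map _ _ _ _).symm⟩⟩
  mul := by
    rintro _ _ _ g ⟨U, hU, a, b, c, h, rfl, rfl, rfl⟩
    obtain ⟨V, hV, t, rfl⟩ := germ_surj g
    have h1 := PartialRing.mul_padd _ _ _ (F.map (homOfLE inf_le_right : U ⊓ V ⟶ V).op t)
      (padd_map (homOfLE inf_le_left : U ⊓ V ⟶ U) h)
    refine ⟨U ⊓ V, ⟨hU, hV⟩, _, _, _, h1, ?_, ?_, ?_⟩ <;>
    exact (congrArg₂ (· * ·) (germ_map _ _ _ _).symm (germ_map _ _ _ _).symm).trans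
      (germ_mul _ _ _).symm

/-- The partial ring structure on the stalks of a presheaf of partial rings. -/
noncomputable instance : PartialRing (Stalk F x) :=
  PartialRing.ofGraph (StalkRel F x) isAddGraph_stalkRel

theorem mem_padd_stalk {g h k : Stalk F x} : k ∈ padd g h ↔ StalkRel F x g h k :=
  mem_graphPart isAddGraph_stalkRel

end StalkRing

/-! ### Locally partial-ringed spaces -/

/-- A locally partial-ringed space: a topological space with a sheaf of partial rings all of whose
stalks are local partial rings. -/
structure LocallyPRingedSpace : Type (u + 1) where
  carrier : TopCat.{u}
  presheaf : carrier.Presheaf PRingCat.{u}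
  isSheaf : presheaf.IsSheaf
  isLocal : ∀ x : carrier, IsLocalPRing (Stalk presheaf x)

attribute [instance] LocallyPRingedSpace.isLocal

section StalkMap

variable {X Y : TopCat.{u}} {F : X.Presheaf PRingCat.{u}} {G : Y.Presheaf PRingCat.{u}}

theorem naturality_apply {f : X ⟶ Y} (φ : G ⟶ (TopCat.Presheaf.pushforward PRingCat f).obj F)
    {U V : Opens Y} (i : V ⟶ U) (s : G.obj (op U)) :
    φ.app (op V) (G.map i.op s) = F.map ((Opens.map f).map i).op (φ.app (op U) s) :=
  congrArg (fun h : G.obj (op U) ⟶ ((TopCat.Presheaf.pushforward PRingCat f).obj F).obj (op V) =>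
    h s) (φ.naturality i.op)

/-- The homomorphism `G_{f(x)} → F_x` induced by `φ : G → f_* F`, which sends the germ of a
section `s` of `G` over `U` to the germ of the section `φ(s)` of `F` over `f⁻¹(U)`. -/
noncomputable def stalkMap (f : X ⟶ Y)
    (φ : G ⟶ (TopCat.Presheaf.pushforward PRingCat f).obj F) (x : X) :
    PRingHom (Stalk G (f x)) (Stalk F x) :=
  have wd : ∀ s t : PreGerm G (f x), s ≈ t →
      germ (F := F) (x := x) (U := (Opens.map f).obj s.nbhd) s.mem (φ.app (op s.nbhd) s.sec) =
      germ (F := F) (x := x) (U := (Opens.map f).obj t.nbhd) t.mem (φ.app (op t.nbhd) t.sec) := by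
    rintro s t ⟨W, hW, i, j, h⟩
    refine germ_eq_iff.2 ⟨(Opens.map f).obj W, hW, (Opens.map f).map i, (Opens.map f).map j, ?_⟩
    have h' := congrArg (φ.app (op W)) h
    rw [naturality_apply, naturality_apply] at h'
    exact h'
  { toFun := Quotient.lift _ wd
    map_zero' := by
      change germ (F := F) (x := x) (U := (Opens.map f).obj ⊤) trivial (φ.app (op ⊤) 0) = 0
      rw [map_zero]
      exact germ_zero _
    map_one' := by
      change germ (F := F) (x := x) (U := (Opens.map f).obj ⊤) trivial (φ.app (op ⊤) 1) = 1
      rw [map_one]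
      exact germ_one _
    map_mul' := by
      intro g h
      obtain ⟨U, hU, s, t, rfl, rfl⟩ := germ_surj₂ g h
      rw [← germ_mul]
      change germ (F := F) (x := x) (U := (Opens.map f).obj U) hU (φ.app (op U) (s * t)) =
        germ (F := F) (x := x) (U := (Opens.map f).obj U) hU (φ.app (op U) s) *
        germ (F := F) (x := x) (U := (Opens.map f).obj U) hU (φ.app (op U) t)
      rw [map_mul]
      exact germ_mul _ _ _
    map_padd' := by
      intro a b c h
      obtain ⟨U, hU, s, t, r, h', rfl, rfl, rfl⟩ := mem_padd_stalk.1 h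
      exact mem_padd_stalk.2 ⟨(Opens.map f).obj U, hU, φ.app (op U) s, φ.app (op U) t,
        φ.app (op U) r, PRingHom.map_padd (A := G.obj (op U))
          (B := F.obj (op ((Opens.map f).obj U))) (φ.app (op U)) h', rfl, rfl, rfl⟩ }

theorem stalkMap_germ (f : X ⟶ Y) (φ : G ⟶ (TopCat.Presheaf.pushforward PRingCat f).obj F)
    (x : X) {U : Opens Y} (hU : f x ∈ U) (s : G.obj (op U)) :
    stalkMap f φ x (germ hU s) =
      germ (F := F) (x := x) (U := (Opens.map f).obj U) hU (φ.app (op U) s) :=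
  rfl

end StalkMap

namespace LocallyPRingedSpace

/-- A morphism `X → Y` of locally partial-ringed spaces: a continuous map `f : X → Y` together
with a homomorphism `𝒪_Y → f_* 𝒪_X` of sheaves of partial rings on `Y` such that for all `x`
the induced map `𝒪_{Y,f(x)} → 𝒪_{X,x}` is a homomorphism of local partial rings. -/
@[ext]
structure Hom (X Y : LocallyPRingedSpace.{u}) where
  base : X.carrier ⟶ Y.carrier
  c : Y.presheaf ⟶ (TopCat.Presheaf.pushforward PRingCat base).obj X.presheaf
  isLocal : ∀ x : X.carrier, (stalkMap base c x).IsLocal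

/-- The partial ring `Γ(X)` of global sections. -/
abbrev Γ (X : LocallyPRingedSpace.{u}) : Type u := X.presheaf.obj (op ⊤)

/-- The homomorphism `Γ(Y) → Γ(X)` induced by a morphism `X → Y`. -/
def Hom.Γ {X Y : LocallyPRingedSpace.{u}} (f : Hom X Y) :
    PRingHom Y.Γ X.Γ :=
  f.c.app (op ⊤)

end LocallyPRingedSpace

/-! ### The spectrum of a partial ring -/

/-- The set of prime ideals of `A`. -/
@[ext]
structure PrimeSpec (A : Type u) [PartialRing A] where
  ideal : PIdeal A
  isPrime : ideal.IsPrime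

section Spec

variable {A : Type u} [PartialRing A]

/-- The set `D(a)` of all prime ideals not containing `a`. -/
def basicOpen (a : A) : Set (PrimeSpec A) := {p | a ∉ p.ideal}

/-- The Zariski topology, generated by the sets `D(a)`. -/
instance : TopologicalSpace (PrimeSpec A) :=
  TopologicalSpace.generateFrom (Set.range basicOpen)

theorem isOpen_basicOpen (a : A) : IsOpen (basicOpen a) :=
  TopologicalSpace.isOpen_generateFrom_of_mem ⟨a, rfl⟩

/-- The localization `A_𝔭` of `A` at the prime ideal `𝔭`. -/
abbrev LocAt (p : PrimeSpec A) : Type u := Localization (p.ideal.primeCompl p.isPrime)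

/-- The fraction `a/s` in `A_𝔭`, for `s ∉ 𝔭`. -/
def frac (p : PrimeSpec A) (a s : A) (hs : s ∉ p.ideal) : LocAt p :=
  Localization.mk a ⟨s, hs⟩

/-- A family of elements `σ(𝔭) ∈ A_𝔭`, for `𝔭 ∈ U`, is locally a fraction if every point of `U`
has an open neighbourhood `V` on which `σ` is given by a fraction `a/s` such that `s` is in no
prime ideal belonging to `V`. -/
def IsLocallyFraction {U : Opens (PrimeSpec A)} (σ : ∀ p : U, LocAt p.1) : Prop :=
  ∀ p : U, ∃ V : Opens (PrimeSpec A), p.1 ∈ V ∧ ∃ a s : A, ∀ q : U, q.1 ∈ V →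
    ∃ hs : s ∉ q.1.ideal, σ q = frac q.1 a s hs

/-- The sections over `U` of the structure sheaf of the spectrum, that is, of the sheaf
associated with the presheaf `U ↦ S_U⁻¹ A`, where `S_U` is the set of all elements of `A` that
are in no prime ideal belonging to `U`. -/
@[ext]
structure Sections (A : Type u) [PartialRing A] (U : Opens (PrimeSpec A)) : Type u where
  val : ∀ p : U, LocAt p.1
  isLocallyFraction : IsLocallyFraction val

namespace Sections

variable {U : Opens (PrimeSpec A)}

theorem mul_notMem (p : PrimeSpec A) {a b : A} (ha : a ∉ p.ideal) (hb : b ∉ p.ideal) :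
    a * b ∉ p.ideal := fun h => (p.isPrime.2 _ _ h).elim ha hb

theorem notMem_of_mul {p : PrimeSpec A} {a b : A} (h : a * b ∉ p.ideal) :
    a ∉ p.ideal ∧ b ∉ p.ideal :=
  ⟨fun ha => h (mul_comm b a ▸ p.ideal.mul_mem b a ha), fun hb => h (p.ideal.mul_mem a b hb)⟩

variable (U) in
/-- The section given by an element of `A`. -/
def const (a : A) : Sections A U :=
  ⟨fun p => frac p.1 a 1 (p.1.ideal.one_notMem p.1.isPrime.1),
    fun _ => ⟨⊤, trivial, a, 1, fun q _ => ⟨q.1.ideal.one_notMem q.1.isPrime.1, rfl⟩⟩⟩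

noncomputable instance : CommMonoidWithZero (Sections A U) where
  mul σ τ := ⟨fun p => σ.1 p * τ.1 p, fun p => by
    obtain ⟨V, hV, a, s, h⟩ := σ.2 p
    obtain ⟨W, hW, b, t, k⟩ := τ.2 p
    refine ⟨V ⊓ W, ⟨hV, hW⟩, a * b, s * t, fun q hq => ?_⟩
    obtain ⟨hs, e1⟩ := h q hq.1
    obtain ⟨ht, e2⟩ := k q hq.2
    refine ⟨mul_notMem q.1 hs ht, ?_⟩
    exact (congrArg₂ (· * ·) e1 e2).trans (Localization.mk_mul _ _ _ _)⟩
  one := const U 1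
  zero := const U 0
  mul_assoc _ _ _ := Sections.ext (funext fun _ => mul_assoc _ _ _)
  mul_comm _ _ := Sections.ext (funext fun _ => mul_comm _ _)
  one_mul σ := Sections.ext (funext fun p =>
    (congrArg (· * σ.1 p) Localization.mk_one).trans (one_mul _))
  mul_one σ := Sections.ext (funext fun p =>
    (congrArg (σ.1 p * ·) Localization.mk_one).trans (mul_one _))
  zero_mul σ := Sections.ext (funext fun p =>
    (congrArg (· * σ.1 p) (Localization.mk_zero _)).trans
      ((zero_mul _).trans (Localization.mk_zero _).symm))
  mul_zero σ := Sections.ext (funext fun p =>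
    (congrArg (σ.1 p * ·) (Localization.mk_zero _)).trans
      ((mul_zero _).trans (Localization.mk_zero _).symm))

theorem mul_apply (σ τ : Sections A U) (p : U) : (σ * τ).1 p = σ.1 p * τ.1 p := rfl

theorem one_apply (p : U) : (1 : Sections A U).1 p = 1 := Localization.mk_one

theorem zero_apply (p : U) : (0 : Sections A U).1 p = 0 := Localization.mk_zero _

/-- A pointwise sum of two sections is a section. -/
theorem isLocallyFraction_padd (σ τ : Sections A U) (ρ : ∀ p : U, LocAt p.1)
    (h : ∀ p, ρ p ∈ padd (σ.1 p) (τ.1 p)) : IsLocallyFraction ρ := by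
  intro p
  obtain ⟨V, hV, a, s, k⟩ := σ.2 p
  obtain ⟨W, hW, b, t, l⟩ := τ.2 p
  obtain ⟨hs, e1⟩ := k p hV
  obtain ⟨ht, e2⟩ := l p hW
  have h0 := h p
  rw [e1, e2] at h0
  obtain ⟨u, c, hc, -⟩ := mem_padd_mk_iff.1 h0
  refine ⟨V ⊓ W ⊓ ⟨_, isOpen_basicOpen (u : A)⟩, ⟨⟨hV, hW⟩, u.2⟩, c, u * t * s, ?_⟩
  rintro q ⟨⟨hqV, hqW⟩, hqu⟩
  obtain ⟨hqs, e3⟩ := k q hqV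
  obtain ⟨hqt, e4⟩ := l q hqW
  refine ⟨mul_notMem _ (mul_notMem _ hqu hqt) hqs, ?_⟩
  have h1 := h q
  rw [e3, e4] at h1
  refine Part.mem_unique h1 (mem_padd_mk_iff.2 ⟨⟨u, hqu⟩, c, hc, rfl⟩)

/-- The graph of the addition of sections.  Two sections are summable if they are so pointwise,
or equivalently (by the definition of the addition in a localization) if locally they are
summable as fractions. -/
def Rel (σ τ ρ : Sections A U) : Prop := ∀ p, ρ.1 p ∈ padd (σ.1 p) (τ.1 p)

theorem isAddGraph_rel : IsAddGraph (Rel (A := A) (U := U)) where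
  functional _ _ _ _ h k := Sections.ext (funext fun p => Part.mem_unique (h p) (k p))
  zero σ p := by
    rw [zero_apply, PartialMagma.padd_zero]
    exact Part.mem_some _
  symm _ _ _ h p := by
    rw [PartialMagma.padd_comm]
    exact h p
  assoc _ b c _ _ h k := by
    choose f hf hf' using fun p => padd_assoc_exists (h p) (k p)
    exact ⟨⟨f, isLocallyFraction_padd b c f hf⟩, hf, hf'⟩
  mul _ _ _ σ h p := PartialRing.mul_padd _ _ _ (σ.1 p) (h p)

noncomputable instance : PartialRing (Sections A U) :=
  PartialRing.ofGraph Rel isAddGraph_rel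

theorem mem_padd {σ τ ρ : Sections A U} :
    ρ ∈ padd σ τ ↔ ∀ p, ρ.1 p ∈ padd (σ.1 p) (τ.1 p) :=
  mem_graphPart isAddGraph_rel

/-- Restriction of sections. -/
def restrict {V : Opens (PrimeSpec A)} (h : V ≤ U) : PRingHom (Sections A U) (Sections A V) where
  toFun σ := ⟨fun p => σ.1 ⟨p.1, h p.2⟩, fun p => by
    obtain ⟨W, hW, a, s, k⟩ := σ.2 ⟨p.1, h p.2⟩
    exact ⟨W, hW, a, s, fun q hq => k ⟨q.1, h q.2⟩ hq⟩⟩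
  map_zero' := rfl
  map_one' := rfl
  map_mul' _ _ := rfl
  map_padd' _ _ _ h := mem_padd.2 fun p => mem_padd.1 h _

/-- The homomorphism `A → Γ(Spec A)` sending `a` to the section `𝔭 ↦ a/1`. -/
def ofElement (A : Type u) [PartialRing A] (U : Opens (PrimeSpec A)) :
    PRingHom A (Sections A U) where
  toFun a := const U a
  map_zero' := rfl
  map_one' := rfl
  map_mul' a b := Sections.ext (funext fun p => by
    rw [mul_apply]
    exact (congrArg (Localization.mk (a * b)) (mul_one _).symm).trans
      (Localization.mk_mul _ _ _ _).symm)
  map_padd' a b c h := mem_padd.2 fun p =>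
    mem_padd_localization.2 ⟨a, b, c, _, h, rfl, rfl, rfl⟩

end Sections

variable (A) in
/-- The spectrum as an object of the category of topological spaces. -/
abbrev specTop : TopCat.{u} := TopCat.of (PrimeSpec A)

variable (A) in
/-- The structure sheaf of the spectrum. -/
noncomputable def structurePresheaf : (specTop A).Presheaf PRingCat.{u} where
  obj U := ⟨Sections A U.unop⟩
  map i := Sections.restrict i.unop.le

theorem structurePresheaf_isSheaf : (structurePresheaf A).IsSheaf := by
  intro E U S hS x hx
  choose V i hi hV using hS
  let y : ∀ (W : Opens (PrimeSpec A)) (j : W ⟶ U) (_ : S j), PRingHom E (Sections A W) :=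
    fun W j hj => x j hj
  have val : ∀ (W : Opens (PrimeSpec A)) (j : W ⟶ U) (hj : S j) (e : E) (p : PrimeSpec A)
      (hpU : p ∈ U) (hp : p ∈ W),
      (y W j hj e).1 ⟨p, hp⟩ = (y _ (i p hpU) (hi p hpU) e).1 ⟨p, hV p hpU⟩ := by
    intro W j hj e p hpU hp
    have h := hx (Y₁ := W) (Y₂ := V p hpU) (Z := W ⊓ V p hpU) (homOfLE inf_le_left)
      (homOfLE inf_le_right) hj (hi p hpU) (Subsingleton.elim _ _)
    exact congrArg (fun φ : PRingHom E (Sections A (W ⊓ V p hpU)) =>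
      (φ e).1 ⟨p, hp, hV p hpU⟩) h
  let v : E → ∀ p : U, LocAt p.1 := fun e p =>
    (y _ (i p.1 p.2) (hi p.1 p.2) e).1 ⟨p.1, hV p.1 p.2⟩
  have hv : ∀ e, IsLocallyFraction (v e) := by
    intro e p
    obtain ⟨W, hW, a, s, k⟩ := (y _ (i p.1 p.2) (hi p.1 p.2) e).2 ⟨p.1, hV p.1 p.2⟩
    refine ⟨W ⊓ V p.1 p.2, ⟨hW, hV p.1 p.2⟩, a, s, fun q hq => ?_⟩
    obtain ⟨hs, h⟩ := k ⟨q.1, hq.2⟩ hq.1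
    exact ⟨hs, (val _ _ (hi p.1 p.2) e q.1 q.2 hq.2).symm.trans h⟩
  let glue : PRingHom E (Sections A U) :=
    { toFun := fun e => ⟨v e, hv e⟩
      map_zero' := Sections.ext (funext fun p =>
        congrArg (fun σ : Sections A _ => σ.1 ⟨p.1, hV p.1 p.2⟩)
          (map_zero (y _ (i p.1 p.2) (hi p.1 p.2))))
      map_one' := Sections.ext (funext fun p =>
        congrArg (fun σ : Sections A _ => σ.1 ⟨p.1, hV p.1 p.2⟩)
          (map_one (y _ (i p.1 p.2) (hi p.1 p.2))))
      map_mul' := fun e e' => Sections.ext (funext fun p =>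
        congrArg (fun σ : Sections A _ => σ.1 ⟨p.1, hV p.1 p.2⟩)
          (map_mul (y _ (i p.1 p.2) (hi p.1 p.2)) e e'))
      map_padd' := fun a b c h => Sections.mem_padd.2 fun p =>
        Sections.mem_padd.1 (PRingHom.map_padd (y _ (i p.1 p.2) (hi p.1 p.2)) h) _ }
  refine ⟨glue, ?_, ?_⟩
  · intro W j hj
    refine PRingHom.ext (A := E) (B := Sections A W) fun e => Sections.ext (funext fun p => ?_)
    exact (val W j hj e p.1 (j.le p.2) p.2).symm
  · intro g hg
    refine PRingHom.ext (A := E) (B := Sections A U) fun e => Sections.ext (funext fun p => ?_)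
    have h := hg (i p.1 p.2) (hi p.1 p.2)
    exact congrArg (fun φ : PRingHom E (Sections A (V p.1 p.2)) =>
      (φ e).1 ⟨p.1, hV p.1 p.2⟩) h

theorem frac_mem_iff {p : PrimeSpec A} {a s b t : A} {hs : s ∉ p.ideal} {ht : t ∉ p.ideal}
    (h : frac p a s hs = frac p b t ht) : a ∈ p.ideal ↔ b ∈ p.ideal := by
  obtain ⟨u, hu⟩ := mk_eq_iff.1 h
  dsimp only at hu
  constructor
  · intro ha
    have h1 := p.ideal.mul_mem u _ (p.ideal.mul_mem t a ha)
    rw [hu] at h1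
    by_contra hb
    exact Sections.mul_notMem p u.2 (Sections.mul_notMem p hs hb) h1
  · intro hb
    have h1 := p.ideal.mul_mem u _ (p.ideal.mul_mem s b hb)
    rw [← hu] at h1
    by_contra ha
    exact Sections.mul_notMem p u.2 (Sections.mul_notMem p ht ha) h1

/-- The ideal `𝔭 A_𝔭` of `A_𝔭`. -/
def locIdeal (p : PrimeSpec A) : PIdeal (LocAt p) where
  carrier := {z | ∃ a s hs, a ∈ p.ideal ∧ z = frac p a s hs}
  zero_mem := ⟨0, 1, p.ideal.one_notMem p.isPrime.1, p.ideal.zero_mem,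
    (Localization.mk_zero _).symm⟩
  padd_mem := by
    rintro _ _ z ⟨a, s, hs, ha, rfl⟩ ⟨b, t, ht, hb, rfl⟩ h
    obtain ⟨u, c, hc, rfl⟩ := mem_padd_mk_iff.1 h
    exact ⟨c, _, _, p.ideal.padd_mem _ _ _ (p.ideal.mul_mem _ _ ha) (p.ideal.mul_mem _ _ hb) hc,
      rfl⟩
  mul_mem := by
    rintro w _ ⟨a, s, hs, ha, rfl⟩
    induction w using Localization.induction_on with
    | H w =>
      refine ⟨w.1 * a, _, Sections.mul_notMem p w.2.2 hs, p.ideal.mul_mem _ _ ha, ?_⟩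
      exact Localization.mk_mul _ _ _ _

theorem frac_mem_locIdeal {p : PrimeSpec A} {a s : A} {hs : s ∉ p.ideal} :
    frac p a s hs ∈ locIdeal p ↔ a ∈ p.ideal := by
  constructor
  · rintro ⟨b, t, ht, hb, h⟩
    exact (frac_mem_iff h).2 hb
  · intro h
    exact ⟨a, s, hs, h, rfl⟩

/-- The value at `𝔭` of a germ at `𝔭` of a section of the structure sheaf. -/
noncomputable def stalkEval (p : specTop A) : PRingHom (Stalk (structurePresheaf A) p) (LocAt p) where
  toFun := Quotient.lift
    (fun s : PreGerm (structurePresheaf A) p => Sections.val (A := A) s.sec ⟨p, s.mem⟩)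
    (by
      rintro s t ⟨W, hW, i, j, h⟩
      exact congrArg (fun σ : Sections A W => σ.1 ⟨p, hW⟩) h)
  map_zero' := Sections.zero_apply _
  map_one' := Sections.one_apply _
  map_mul' g h := by
    obtain ⟨U, hU, s, t, rfl, rfl⟩ := germ_surj₂ g h
    rw [← germ_mul]
    rfl
  map_padd' g h k hk := by
    obtain ⟨U, hU, s, t, r, hr, rfl, rfl, rfl⟩ := mem_padd_stalk.1 hk
    exact Sections.mem_padd.1 hr ⟨p, hU⟩

theorem stalk_isLocal (p : specTop A) : IsLocalPRing (Stalk (structurePresheaf A) p) := by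
  refine ⟨existsUnique_isMaximal ((locIdeal p).comap (stalkEval p)) ?_ ?_⟩
  · intro h
    have h1 : (1 : Stalk (structurePresheaf A) p) ∈ (locIdeal p).comap (stalkEval p) :=
      Set.eq_univ_iff_forall.1 h 1
    have h2 : stalkEval p 1 ∈ locIdeal p := h1
    rw [map_one, ← Localization.mk_one] at h2
    exact p.ideal.one_notMem p.isPrime.1 (frac_mem_locIdeal.1 h2)
  · intro g hg
    obtain ⟨U, hU, σ, rfl⟩ := germ_surj g
    have hg : Sections.val (A := A) σ ⟨p, hU⟩ ∉ locIdeal p := hg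
    obtain ⟨V, hV, a, s, h⟩ := Sections.isLocallyFraction (A := A) σ ⟨p, hU⟩
    obtain ⟨hs, e⟩ := h ⟨p, hU⟩ hV
    rw [e, frac_mem_locIdeal] at hg
    let W : Opens (PrimeSpec A) := U ⊓ V ⊓ ⟨_, isOpen_basicOpen a⟩
    have hW : p ∈ W := ⟨⟨hU, hV⟩, hg⟩
    let τ : Sections A W := ⟨fun q => frac q.1 s a q.2.2, fun q =>
      ⟨W, q.2, s, a, fun r hr => ⟨hr.2, rfl⟩⟩⟩
    refine ⟨germ (F := structurePresheaf A) hW τ, ?_⟩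
    rw [← germ_map (F := structurePresheaf A) hW hU (homOfLE (inf_le_left.trans inf_le_left)) σ]
    refine (germ_mul (F := structurePresheaf A) hW _ _).symm.trans ?_
    refine Eq.trans ?_ (germ_one hW)
    refine congrArg (germ (F := structurePresheaf A) hW) (Sections.ext (funext fun q => ?_) :
      τ * Sections.restrict (inf_le_left.trans inf_le_left) σ = (1 : Sections A W))
    obtain ⟨hs, e⟩ := h ⟨q.1, q.2.1.1⟩ q.2.1.2
    rw [Sections.mul_apply, Sections.one_apply]
    refine (congrArg (fun z => τ.1 q * z) e).trans ?_
    refine (Localization.mk_mul _ _ _ _).trans ?_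
    rw [← Localization.mk_one, mk_eq_iff]
    refine ⟨1, ?_⟩
    simp only [Submonoid.coe_mul, Submonoid.coe_one, mul_one, one_mul]
    exact mul_comm _ _

end Spec

/-- The spectrum of a partial ring, as a locally partial-ringed space. -/
noncomputable def Spec (A : Type u) [PartialRing A] : LocallyPRingedSpace.{u} where
  carrier := specTop A
  presheaf := structurePresheaf A
  isSheaf := structurePresheaf_isSheaf
  isLocal := stalk_isLocal

/-- The canonical homomorphism `γ : A → Γ(Spec A)`, which sends `a` to the global section
`𝔭 ↦ a/1`. -/
noncomputable def toΓSpec (A : Type u) [PartialRing A] : PRingHom A (Spec A).Γ :=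
  Sections.ofElement A ⊤

end PartialSchemes

/-!
A morphism `f : Spec A → Spec B` is determined by `φ = Γ(f) ∘ γ_B` for the usual two reasons.

* The maximal ideal of the stalk at `𝔭` consists of the germs whose value lies in `𝔭 A_𝔭`, because
  `stalkEval` identifies the stalk with `A_𝔭` (`stalkEval_injective`, `stalkEval_surjective`,
  `maximalIdeal_stalk_eq`).  Locality of the stalk maps thus forces
  `f(𝔭) = {b | φ(b)(𝔭) ∈ 𝔭 A_𝔭}` (`mem_ideal_base_iff`).
* If a section `σ` equals `b/t` near `f(𝔭)`, then `φ(t)(𝔭) · f^#(σ)(𝔭) = φ(b)(𝔭)`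
  (`Hom.apply_mul_val_app`), and `φ(t)(𝔭)` is a unit of `A_𝔭`, so that `f^#(σ)(𝔭)` is determined.

Conversely, a homomorphism `φ : B → Γ(Spec A)` defines a map on points by the first formula
(`comapPoint`).  At each point, `b ↦ φ(b)(𝔭)` factors through a homomorphism
`B_{f(𝔭)} → A_𝔭` (`localHom`), and applying these homomorphisms pointwise takes sections to
sections (`sectionsHom`), since a quotient of two local fractions whose denominator is a unit at
`𝔭` is again a fraction near `𝔭`.  Addition needs no separate argument: the sections are added
pointwise, and any two summable fractions have summable numerators over a common denominator.
-/

namespace PartialSchemes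

open PartialMagma

/-! ### The universal property of localization -/

section Lift

variable {B C : Type u} [PartialRing B] [PartialRing C] {S : Submonoid B}

/-- The homomorphism `S⁻¹B → C` induced by a homomorphism `B → C` that takes `S` to units. -/
noncomputable def locLift (ψ : PRingHom B C) (h : ∀ s : S, IsUnit (ψ s)) :
    PRingHom (Localization S) C where
  toMonoidWithZeroHom := (Localization.monoidOf S).lift₀ ψ.toMonoidWithZeroHom h
  map_padd' x y z hz := by
    obtain ⟨a, b, c, s, hc, rfl, rfl, rfl⟩ := mem_padd_localization.1 hz
    obtain ⟨v, hv⟩ := (h s).exists_left_inv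
    have key : ∀ d : B, (Localization.monoidOf S).lift₀ ψ.toMonoidWithZeroHom h
        (Localization.mk d s) = ψ d * v := fun d => by
      rw [Localization.mk_eq_monoidOf_mk']
      refine ((Localization.monoidOf S).lift_mk'_spec (g := (ψ.toMonoidWithZeroHom : B →* C))
        h d (ψ d * v) s).2 ?_
      change ψ d = ψ s * (ψ d * v)
      calc ψ d = (v * ψ s) * ψ d := by rw [hv, one_mul]
        _ = _ := by ac_rfl
    change (Localization.monoidOf S).lift₀ ψ.toMonoidWithZeroHom h (Localization.mk c s) ∈
      padd ((Localization.monoidOf S).lift₀ ψ.toMonoidWithZeroHom h (Localization.mk a s))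
        ((Localization.monoidOf S).lift₀ ψ.toMonoidWithZeroHom h (Localization.mk b s))
    rw [key, key, key]
    exact PartialRing.mul_padd _ _ _ v (ψ.map_padd hc)

theorem mul_locLift_mk (ψ : PRingHom B C) (h : ∀ s : S, IsUnit (ψ s)) (b : B) (s : S) :
    ψ s * locLift ψ h (Localization.mk b s) = ψ b := by
  rw [Localization.mk_eq_monoidOf_mk']
  exact (((Localization.monoidOf S).lift_mk'_spec (g := (ψ.toMonoidWithZeroHom : B →* C))
        h b _ s).1 rfl).symm

end Lift

/-! ### The local partial ring at a point, and the stalk -/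

section Point

variable {A : Type u} [PartialRing A]

theorem one_notMem_locIdeal (p : PrimeSpec A) : (1 : LocAt p) ∉ locIdeal p := by
  rw [← Localization.mk_one]
  exact fun h => p.ideal.one_notMem p.isPrime.1 (frac_mem_locIdeal.1 h)

theorem isUnit_iff_notMem_locIdeal {p : PrimeSpec A} {z : LocAt p} :
    IsUnit z ↔ z ∉ locIdeal p := by
  constructor
  · intro h hz
    obtain ⟨w, hw⟩ := h.exists_left_inv
    exact one_notMem_locIdeal p (hw ▸ (locIdeal p).mul_mem w z hz)
  · induction z using Localization.induction_on with
    | H z =>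
      intro h
      have ha : z.1 ∉ p.ideal := fun ha => h (frac_mem_locIdeal.2 ha)
      refine .of_mul_eq_one (frac p z.2 z.1 ha) ?_
      refine (Localization.mk_mul _ _ _ _).trans ?_
      rw [← Localization.mk_one, mk_eq_iff]
      refine ⟨1, ?_⟩
      simp only [Submonoid.coe_mul, Submonoid.coe_one, mul_one, one_mul]
      exact mul_comm _ _

theorem locIdeal_isPrime (p : PrimeSpec A) : (locIdeal p).IsPrime := by
  refine ⟨fun h => one_notMem_locIdeal p (Set.eq_univ_iff_forall.1 h 1), fun a b h => ?_⟩
  by_contra! hab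
  exact isUnit_iff_notMem_locIdeal.1 ((isUnit_iff_notMem_locIdeal.2 hab.1).mul
    (isUnit_iff_notMem_locIdeal.2 hab.2)) h

theorem mul_frac (p : PrimeSpec A) (b t : A) (ht : t ∉ p.ideal) :
    frac p t 1 (p.ideal.one_notMem p.isPrime.1) * frac p b t ht =
      frac p b 1 (p.ideal.one_notMem p.isPrime.1) := by
  refine (Localization.mk_mul _ _ _ _).trans (mk_eq_iff.2 ⟨1, ?_⟩)
  simp only [Submonoid.coe_mul, Submonoid.coe_one, one_mul]

/-- The value of a section at a point, as a homomorphism. -/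
noncomputable def Sections.eval {U : Opens (PrimeSpec A)} (p : U) :
    PRingHom (Sections A U) (LocAt p.1) where
  toFun σ := σ.1 p
  map_zero' := Sections.zero_apply p
  map_one' := Sections.one_apply p
  map_mul' _ _ := rfl
  map_padd' _ _ _ h := Sections.mem_padd.1 h p

/-- Two sections with the same value at a point agree near it: equal fractions `a/s = b/t` stay
equal wherever the element witnessing the equality does not vanish. -/
theorem stalkEval_injective (p : specTop A) : Function.Injective (stalkEval p) := by
  intro g h e
  obtain ⟨U, hU, σ, τ, rfl, rfl⟩ := germ_surj₂ g h
  have e : Sections.val (A := A) σ ⟨p, hU⟩ = Sections.val (A := A) τ ⟨p, hU⟩ := e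
  obtain ⟨V, hV, a, s, k⟩ := Sections.isLocallyFraction (A := A) σ ⟨p, hU⟩
  obtain ⟨W, hW, b, t, l⟩ := Sections.isLocallyFraction (A := A) τ ⟨p, hU⟩
  obtain ⟨hs, e1⟩ := k ⟨p, hU⟩ hV
  obtain ⟨ht, e2⟩ := l ⟨p, hU⟩ hW
  rw [e1, e2] at e
  obtain ⟨u, hu⟩ := mk_eq_iff.1 e
  refine germ_eq_iff.2 ⟨U ⊓ (V ⊓ W ⊓ ⟨_, isOpen_basicOpen (u : A)⟩), ⟨hU, ⟨hV, hW⟩, u.2⟩,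
    homOfLE inf_le_left, homOfLE inf_le_left, Sections.ext (funext fun q => ?_)⟩
  obtain ⟨_, e3⟩ := k ⟨q.1, q.2.1⟩ q.2.2.1.1
  obtain ⟨_, e4⟩ := l ⟨q.1, q.2.1⟩ q.2.2.1.2
  exact e3.trans (Eq.trans (mk_eq_iff.2 ⟨⟨u, q.2.2.2⟩, hu⟩) e4.symm)

theorem stalkEval_surjective (p : specTop A) : Function.Surjective (stalkEval p) := by
  intro z
  induction z using Localization.induction_on with
  | H z =>
    let W : Opens (PrimeSpec A) := ⟨_, isOpen_basicOpen (z.2 : A)⟩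
    let σ : Sections A W := ⟨fun q => frac q.1 z.1 z.2 q.2, fun q =>
      ⟨W, q.2, z.1, z.2, fun r _ => ⟨r.2, rfl⟩⟩⟩
    exact ⟨germ (F := structurePresheaf A) (U := W) z.2.2 σ, rfl⟩

instance (p : specTop A) : IsLocalPRing (Stalk (structurePresheaf A) p) := stalk_isLocal p

theorem maximalIdeal_stalk_eq (p : specTop A) :
    maximalIdeal (Stalk (structurePresheaf A) p) = (locIdeal p).comap (stalkEval p) := by
  refine (IsLocalPRing.existsUnique.choose_spec.2 _ ⟨fun h => ?_, fun J hJ hIJ => ?_⟩).symm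
  · refine one_notMem_locIdeal p ?_
    rw [← map_one (stalkEval p)]
    exact Set.eq_univ_iff_forall.1 h 1
  · refine SetLike.coe_injective (Set.Subset.antisymm (fun g hg => ?_) hIJ)
    by_contra hgI
    obtain ⟨w, hw⟩ := (isUnit_iff_notMem_locIdeal.2 hgI : IsUnit (stalkEval p g)).exists_left_inv
    obtain ⟨h, rfl⟩ := stalkEval_surjective p w
    rw [← map_mul, ← map_one (stalkEval p)] at hw
    exact J.one_notMem hJ (stalkEval_injective p hw ▸ J.mul_mem h g hg)

end Point

/-! ### The morphism defined by a homomorphism to the global sections -/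

section Construction

variable {A B : Type u} [PartialRing A] [PartialRing B] (φ : PRingHom B (Sections A ⊤))

/-- The homomorphism `B → A_𝔭`, `b ↦ φ(b)(𝔭)`. -/
noncomputable def evalHom (p : PrimeSpec A) : PRingHom B (LocAt p) :=
  (Sections.eval (U := ⊤) ⟨p, trivial⟩).comp φ

/-- The prime ideal of all `b` such that `φ(b)` vanishes at `𝔭`. -/
noncomputable def comapPoint (p : PrimeSpec A) : PrimeSpec B where
  ideal := (locIdeal p).comap (evalHom φ p)
  isPrime := by
    refine ⟨fun h => one_notMem_locIdeal p ?_, fun a b h => (locIdeal_isPrime p).2 _ _ ?_⟩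
    · rw [← map_one (evalHom φ p)]
      exact Set.eq_univ_iff_forall.1 h 1
    · rw [← map_mul]
      exact h

variable {φ} in
theorem notMem_comapPoint_iff {p : PrimeSpec A} {b : B} :
    b ∉ (comapPoint φ p).ideal ↔ IsUnit (evalHom φ p b) :=
  isUnit_iff_notMem_locIdeal.symm

theorem continuous_comapPoint : Continuous (comapPoint φ) := by
  refine continuous_generateFrom_iff.2 ?_
  rintro _ ⟨b, rfl⟩
  refine isOpen_iff_forall_mem_open.2 fun p hp => ?_
  obtain ⟨V, hV, a, s, k⟩ := (φ b).2 ⟨p, trivial⟩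
  have mem_iff : ∀ q ∈ V, comapPoint φ q ∈ basicOpen b ↔ a ∉ q.ideal := fun q hq => by
    obtain ⟨hs, e⟩ := k ⟨q, trivial⟩ hq
    change (φ b).1 ⟨q, trivial⟩ ∉ locIdeal q ↔ _
    rw [e, frac_mem_locIdeal]
  exact ⟨V ∩ basicOpen a, fun q hq => (mem_iff q hq.1).2 hq.2,
    V.isOpen.inter (isOpen_basicOpen a), hV, (mem_iff p hV).1 hp⟩

/-- The homomorphism `B_{f(𝔭)} → A_𝔭` induced by `φ`, where `f = comapPoint φ`. -/
noncomputable def localHom (p : PrimeSpec A) : PRingHom (LocAt (comapPoint φ p)) (LocAt p) :=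
  locLift (evalHom φ p) fun s => notMem_comapPoint_iff.1 s.2

theorem mul_localHom_frac (p : PrimeSpec A) (b t : B) (ht : t ∉ (comapPoint φ p).ideal) :
    evalHom φ p t * localHom φ p (frac _ b t ht) = evalHom φ p b :=
  mul_locLift_mk _ _ _ _

theorem localHom_frac_one (p : PrimeSpec A) (b : B) :
    localHom φ p (frac _ b 1 (PIdeal.one_notMem _ (comapPoint φ p).isPrime.1)) =
      evalHom φ p b := by
  have h := mul_localHom_frac φ p b 1 (PIdeal.one_notMem _ (comapPoint φ p).isPrime.1)
  rwa [map_one, one_mul] at h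

theorem localHom_mem_locIdeal_iff {p : PrimeSpec A} {z : LocAt (comapPoint φ p)} :
    localHom φ p z ∈ locIdeal p ↔ z ∈ locIdeal (comapPoint φ p) := by
  constructor
  · contrapose!
    intro h
    exact isUnit_iff_notMem_locIdeal.1 ((isUnit_iff_notMem_locIdeal.2 h).map (localHom φ p))
  · rintro ⟨b, t, ht, hb, rfl⟩
    by_contra h
    refine isUnit_iff_notMem_locIdeal.1 ?_ hb
    rw [← mul_localHom_frac φ p b t ht]
    exact (notMem_comapPoint_iff.1 ht).mul (isUnit_iff_notMem_locIdeal.2 h)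

/-- Applying `localHom` pointwise takes sections to sections: if `φ(b) = a/s` and `φ(t) = a'/s'`
near `𝔭`, then `b/t` is mapped to `a s' / s a'`. -/
theorem isLocallyFraction_localHom {U : Opens (PrimeSpec B)} {V : Opens (PrimeSpec A)}
    (h : ∀ p ∈ V, comapPoint φ p ∈ U) (σ : Sections B U) :
    IsLocallyFraction (U := V) fun p => localHom φ p.1 (σ.1 ⟨comapPoint φ p.1, h p.1 p.2⟩) := by
  intro p
  obtain ⟨W, hW, b, t, k⟩ := σ.2 ⟨comapPoint φ p.1, h p.1 p.2⟩
  obtain ⟨V₁, hV₁, a, s, k₁⟩ := (φ b).2 ⟨p.1, trivial⟩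
  obtain ⟨V₂, hV₂, a', s', k₂⟩ := (φ t).2 ⟨p.1, trivial⟩
  refine ⟨V₁ ⊓ V₂ ⊓ ⟨_, W.isOpen.preimage (continuous_comapPoint φ)⟩, ⟨⟨hV₁, hV₂⟩, hW⟩,
    a * s', s * a', ?_⟩
  rintro q ⟨⟨hq₁, hq₂⟩, hqW⟩
  obtain ⟨ht, e⟩ := k ⟨comapPoint φ q.1, h q.1 q.2⟩ hqW
  obtain ⟨hs, e₁⟩ := k₁ ⟨q.1, trivial⟩ hq₁
  obtain ⟨hs', e₂⟩ := k₂ ⟨q.1, trivial⟩ hq₂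
  have e₁ : evalHom φ q.1 b = frac q.1 a s hs := e₁
  have e₂ : evalHom φ q.1 t = frac q.1 a' s' hs' := e₂
  have hu := notMem_comapPoint_iff.1 ht
  have ha' : a' ∉ q.1.ideal := by
    rw [e₂, isUnit_iff_notMem_locIdeal, frac_mem_locIdeal] at hu
    exact hu
  refine ⟨Sections.mul_notMem _ hs ha', hu.mul_left_cancel ?_⟩
  beta_reduce
  rw [e, mul_localHom_frac, e₁, e₂]
  refine Eq.symm ((Localization.mk_mul _ _ _ _).trans (mk_eq_iff.2 ⟨1, ?_⟩))
  simp only [Submonoid.coe_mul, Submonoid.coe_one, one_mul]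
  ac_rfl

/-- The homomorphism on sections induced by `φ`, given pointwise by `localHom`. -/
noncomputable def sectionsHom {U : Opens (PrimeSpec B)} {V : Opens (PrimeSpec A)}
    (h : ∀ p ∈ V, comapPoint φ p ∈ U) : PRingHom (Sections B U) (Sections A V) where
  toFun σ := ⟨_, isLocallyFraction_localHom φ h σ⟩
  map_zero' := Sections.ext (funext fun p => by
    dsimp only
    rw [Sections.zero_apply, Sections.zero_apply, map_zero])
  map_one' := Sections.ext (funext fun p => by
    dsimp only
    rw [Sections.one_apply, Sections.one_apply, map_one])
  map_mul' σ τ := Sections.ext (funext fun p => map_mul (localHom φ p.1) _ _)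
  map_padd' _ _ _ hk := Sections.mem_padd.2 fun p =>
    (localHom φ p.1).map_padd (Sections.mem_padd.1 hk _)

/-- The morphism `Spec A → Spec B` defined by a homomorphism `B → Γ(Spec A)`. -/
noncomputable def homOfΓ : LocallyPRingedSpace.Hom (Spec A) (Spec B) where
  base := TopCat.ofHom ⟨comapPoint φ, continuous_comapPoint φ⟩
  c :=
    { app := fun U => sectionsHom φ (U := U.unop)
        (V := ⟨_, U.unop.isOpen.preimage (continuous_comapPoint φ)⟩) fun _ hp => hp
      naturality := fun _ _ _ => rfl }
  isLocal := fun (p : specTop A) => by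
    let y : specTop B := comapPoint φ p
    refine (congrArg (PIdeal.comap (A := Stalk (structurePresheaf B) y)
      (B := Stalk (structurePresheaf A) p) _) (maximalIdeal_stalk_eq (A := A) p)).trans
      (Eq.trans ?_ (maximalIdeal_stalk_eq (A := B) y).symm)
    refine SetLike.ext fun g => ?_
    obtain ⟨U, hU, σ, rfl⟩ := germ_surj g
    exact localHom_mem_locIdeal_iff φ

theorem homOfΓ_Γ_comp : (homOfΓ φ).Γ.comp (toΓSpec B) = φ :=
  PRingHom.ext (A := B) (B := Sections A ⊤) fun b =>
    Sections.ext (funext fun p => localHom_frac_one φ p.1 b)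

end Construction

/-! ### A morphism is determined by its effect on global sections -/

section Uniqueness

open LocallyPRingedSpace

variable {A B : Type u} [PartialRing A] [PartialRing B]
  (f : Hom (Spec A) (Spec B))

/-- The homomorphism `Γ(f) ∘ γ_B : B → Γ(Spec A)` attached to a morphism `f`. -/
noncomputable abbrev LocallyPRingedSpace.Hom.toΓ : PRingHom B (Sections A ⊤) :=
  f.Γ.comp (toΓSpec B)

/-- The homomorphism `𝒪_{Spec B, f(𝔭)} → 𝒪_{Spec A, 𝔭} → A_𝔭`. -/
noncomputable def LocallyPRingedSpace.Hom.stalkHom (p : (Spec A).carrier) :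
    PRingHom (Stalk (Spec B).presheaf (f.base p)) (LocAt (A := A) p) :=
  PRingHom.comp (B := Stalk (Spec A).presheaf p) (stalkEval (A := A) p) (stalkMap f.base f.c p)

/-- The value `φ(b)(𝔭)` depends on the germ at `f(𝔭)` of the section `b/1` only, over whichever
neighbourhood of `f(𝔭)` this section is considered. -/
theorem LocallyPRingedSpace.Hom.evalHom_toΓ {U : Opens (PrimeSpec B)} {p : PrimeSpec A}
    (hp : f.base p ∈ U) (b : B) :
    evalHom (Hom.toΓ f) p b =
      Hom.stalkHom f p (germ (F := (Spec B).presheaf) hp (Sections.const U b)) :=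
  congrArg (Hom.stalkHom f p) (germ_map (F := (Spec B).presheaf) hp (U := ⊤) trivial
    (homOfLE le_top) (Sections.const ⊤ b)).symm

/-- The ideal of `f(𝔭)` is determined by `φ = Γ(f) ∘ γ_B`, because the stalk map at `𝔭` is local. -/
theorem mem_ideal_base_iff (p : (Spec A).carrier) (b : B) :
    b ∈ PrimeSpec.ideal (f.base p) ↔ evalHom (Hom.toΓ f) p b ∈ locIdeal (A := A) p := by
  have h := (congrArg (PIdeal.comap (stalkMap f.base f.c p))
    (maximalIdeal_stalk_eq (A := A) p)).symm.trans
      ((f.isLocal p).trans (maximalIdeal_stalk_eq (A := B) (f.base p)))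
  have h' := SetLike.ext_iff.1 h (germ (F := (Spec B).presheaf) (U := ⊤) trivial
    (Sections.const ⊤ b))
  exact (h'.trans frac_mem_locIdeal).symm

theorem base_apply_eq_comapPoint (p : PrimeSpec A) : f.base p = comapPoint (Hom.toΓ f) p :=
  PrimeSpec.ext (SetLike.ext fun b => mem_ideal_base_iff f p b)

/-- If `σ = b/t` near `f(𝔭)`, then `φ(t)(𝔭) · f^#(σ)(𝔭) = φ(b)(𝔭)`, where `φ = Γ(f) ∘ γ_B`. -/
theorem LocallyPRingedSpace.Hom.apply_mul_val_app {U W : Opens (PrimeSpec B)} (σ : Sections B U)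
    {p : PrimeSpec A} (hU : f.base p ∈ U) (hW : f.base p ∈ W) {b t : B}
    (h : ∀ q : U, q.1 ∈ W → ∃ ht : t ∉ q.1.ideal, σ.1 q = frac q.1 b t ht) :
    evalHom (Hom.toΓ f) p t *
      Sections.val (A := A) (f.c.app (op U) σ) ⟨p, hU⟩ = evalHom (Hom.toΓ f) p b := by
  have hUW : f.base p ∈ U ⊓ W := ⟨hU, hW⟩
  rw [Hom.evalHom_toΓ f hUW t, Hom.evalHom_toΓ f hUW b]
  change _ * Hom.stalkHom f p (germ (F := (Spec B).presheaf) hU σ) = _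
  rw [← map_mul, ← germ_map (F := (Spec B).presheaf) hUW hU (homOfLE inf_le_left) σ]
  refine congrArg (Hom.stalkHom f p)
    ((germ_mul (F := (Spec B).presheaf) hUW _ _).symm.trans
      (congrArg (germ (F := (Spec B).presheaf) hUW) (Sections.ext (funext fun q => ?_))))
  obtain ⟨ht, e⟩ := h ⟨q.1, q.2.1⟩ q.2.2
  exact (congrArg (fun z => frac q.1 t 1 _ * z) e).trans (mul_frac q.1 b t ht)

theorem LocallyPRingedSpace.Hom.toΓ_injective :
    Function.Injective (Hom.toΓ (A := A) (B := B)) := by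
  intro f g h
  have hb : f.base = g.base := ConcreteCategory.hom_ext _ _ fun p => by
    rw [base_apply_eq_comapPoint f p, h]
    exact (base_apply_eq_comapPoint g p).symm
  obtain ⟨base, c, hf⟩ := f
  obtain ⟨base', c', hg⟩ := g
  obtain rfl : base = base' := hb
  have hc : c = c' := by
    refine NatTrans.ext (funext fun (U : (Opens (PrimeSpec B))ᵒᵖ) => ?_)
    let V : Opens (PrimeSpec A) := (Opens.map base).obj U.unop
    refine PRingHom.ext (A := Sections B U.unop) (B := Sections A V) fun σ =>
      Sections.ext (funext fun p => ?_)
    obtain ⟨W, hW, b, t, k⟩ := Sections.isLocallyFraction σ ⟨base p.1, p.2⟩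
    have ef := Hom.apply_mul_val_app ⟨base, c, hf⟩ σ (p := p.1) p.2 hW k
    have eg := Hom.apply_mul_val_app ⟨base, c', hg⟩ σ (p := p.1) p.2 hW k
    rw [← h] at eg
    obtain ⟨ht, -⟩ := k ⟨base p.1, p.2⟩ hW
    -- The denominator `t` does not vanish at `f(𝔭)`, so its image in `A_𝔭` can be cancelled.
    have hu : IsUnit (evalHom (Hom.toΓ ⟨base, c, hf⟩) p.1 t) :=
      isUnit_iff_notMem_locIdeal.2 fun h' =>
        ht ((mem_ideal_base_iff ⟨base, c, hf⟩ p.1 t).2 h')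
    exact hu.mul_left_cancel (ef.trans eg.symm)
  subst hc
  rfl

end Uniqueness

end PartialSchemes

theorem mainTheorem4 (A B : Type u) [PartialSchemes.PartialRing A] [PartialSchemes.PartialRing B] :
    Function.Bijective
      (fun f : PartialSchemes.LocallyPRingedSpace.Hom (PartialSchemes.Spec A)
          (PartialSchemes.Spec B) =>
        (PartialSchemes.PRingHom.comp f.Γ (PartialSchemes.toΓSpec B) :
          PartialSchemes.PRingHom B (PartialSchemes.Spec A).Γ)) := by
  exact ⟨PartialSchemes.LocallyPRingedSpace.Hom.toΓ_injective,
    fun φ => ⟨_, PartialSchemes.homOfΓ_Γ_comp φ⟩⟩
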